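/- Let $w\ge 0$ be a function on $[0,2\pi]$ that is continuous with $w(0)=w(2\pi)$ and differentiable on $(0,2\pi)$, with $w'$ integrable, such that $d\mu(\theta)=w(\theta)\frac{d\theta}{2\pi}$ is a probability measure on the unit circle. Let $\Phi_k$ and $\varphi_k$ be the monic orthogonal and the orthonormal polynomials of $\mu$, for a polynomial $p$ of degree $k$ put $p^*(z)=z^{k}\overline{p(1/\bar z)}$, and let $\alpha_k=-\overline{\Phi_{k+1}(0)}$ be the Verblunsky coefficients, i.e. $\Phi_{k+1}(z)=z\Phi_k(z)-\bar\alpha_k\Phi_k^*(z)$. Fix $n\ge 1$ and $\beta\in\mathbb{C}$ and set $$\Phi_n(z;\beta)=z\Phi_{n-1}(z)-\bar\beta\,\Phi_{n-1}^*(z)$$ (for $|\beta|=1$ this is the paraorthogonal polynomial). For $|z|\neq 1$ define \begin{align*} G_n(z)&=i\int_0^{2\pi}\frac{|\varphi_{n-1}^*(e^{i\theta})|^2w'(\theta)}{z-e^{i\theta}}\frac{d\theta}{2\pi},\\ D_n(z)&=-iz\int_0^{2\pi}\frac{\varphi_{n-1}^*(e^{i\theta})^2w'(\theta)}{(z-e^{i\theta})e^{in\theta}}\frac{d\theta}{2\pi},\\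 J_n(z)&=i\int_0^{2\pi}\frac{\varphi_{n-1}(e^{i\theta})^2w'(\theta)}{(z-e^{i\theta})e^{i(n-2)\theta}}\frac{d\theta}{2\pi},\\ h_n(z;x;y)&=\bar x\big(n(1-\bar y\alpha_{n-1})+zG_n(z)+\bar yD_n(z)\big)-z\big(J_n(z)-\bar yG_n(z)\big), \end{align*} and let $W[f,g]=fg'-gf'$, all derivatives being taken with respect to $z$. Put \begin{align*} P(z)&=\frac{1-n}{z}-\frac{h_n'(z;\beta;\beta)}{h_n(z;\beta;\beta)},\\ Q(z)&=\frac{W[h_n(z;\beta;\beta),h_n(z;-\beta;\beta)]}{2\bar\beta z\,h_n(z;\beta;\beta)}-\frac1z\Big((n+zG_n(z))G_n(z)+J_n(z)(D_n(z)-n\alpha_{n-1})\Big), \end{align*} where for $\beta=0$ the quotient $W[h_n(z;\beta;\beta),h_n(z;-\beta;\beta)]/(2\bar\beta)$ stands for its limit as $\beta\to0$, which is $W[zJ_n(z),\,n+zG_n(z)]$. Then $y(z)=\Phi_n(z;\beta)$ satisfies $$y''(z)+P(z)y'(z)+Q(z)y(z)=0$$ at every $z\ne0$ with $|z|\neq1$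 and $h_n(z;\beta;\beta)\neq0$. Moreover, let $\Omega$ be a domain in the Riemann sphere that contains $0$ (respectively $\infty$), suppose that $h_n(\cdot;\beta;\beta)$ does not vanish identically near that point, and suppose that the germs of $P$ and $Q$ at that point extend to meromorphic functions on $\Omega$. Then the same equation, with the extended coefficients, holds on $\Omega$ at every finite point at which both extended coefficients are analytic. -/

import Mathlib

open MeasureTheory Polynomial Filter Topology

noncomputable section

namespace OPUC

/-- The measure `w(θ) dθ/2π` on the unit circle, written in the variable `θ ∈ [0, 2π)`. -/
def weightMeasure (w : ℝ → ℝ) : Measure ℝ :=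
  (volume.restrict (Set.Ico 0 (2 * Real.pi))).withDensity
    (fun θ => ENNReal.ofReal (w θ / (2 * Real.pi)))

/-- The point `e^{iθ}` of the unit circle. -/
def expi (θ : ℝ) : ℂ := Complex.exp (Complex.I * θ)

/-- The pairing `∫ p(e^{iθ}) conj (q(e^{iθ})) dμ(θ)` on polynomials. -/
def pairing (μ : Measure ℝ) (p q : ℂ[X]) : ℂ :=
  ∫ θ, p.eval (expi θ) * starRingEnd ℂ (q.eval (expi θ)) ∂μ

/-- The monic orthogonal polynomials `Φ_n(z; μ)`: Gram-Schmidt applied to `1, z, z², …`. -/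
def monicOP (μ : Measure ℝ) : ℕ → ℂ[X]
  | n => X ^ n - ∑ k : Fin n,
      C (pairing μ (X ^ n) (monicOP μ k) / pairing μ (monicOP μ k) (monicOP μ k)) * monicOP μ k
decreasing_by exact k.2

/-- The `L²(μ)` norm of `Φ_n`, that is `1 / κ_n`. -/
def normOP (μ : Measure ℝ) (n : ℕ) : ℝ :=
  Real.sqrt (∫ θ, ‖(monicOP μ n).eval (expi θ)‖ ^ 2 ∂μ)

/-- The orthonormal polynomials `φ_n = Φ_n / ‖Φ_n‖`. -/
def orthonormalOP (μ : Measure ℝ) (n : ℕ) : ℂ[X] :=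
  C (((normOP μ n)⁻¹ : ℝ) : ℂ) * monicOP μ n

/-- The reversed polynomial `p^*(z) = z^n conj (p(1 / conj z))` of a polynomial `p` of degree at
most `n`: the coefficients are conjugated and `z^k` is exchanged with `z^(n-k)`. -/
def revPoly (n : ℕ) (p : ℂ[X]) : ℂ[X] := (p.map (starRingEnd ℂ)).reflect n

/-- The Verblunsky coefficient `α_n`. It is the number in the Szegő recursion
`Φ_{n+1}(z) = z Φ_n(z) - conj α_n Φ_n^*(z)`; as `Φ_n^*(0) = 1`, it is `-conj Φ_{n+1}(0)`. -/
def verblunsky (μ : Measure ℝ) (n : ℕ) : ℂ := -starRingEnd ℂ ((monicOP μ (n + 1)).eval 0)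

/-- `Φ_n(z; β) = z Φ_{n-1}(z) - conj β Φ_{n-1}^*(z)`, for `n ≥ 1`. -/
def paraOP (μ : Measure ℝ) (n : ℕ) (β : ℂ) : ℂ[X] :=
  X * monicOP μ (n - 1) - C (starRingEnd ℂ β) * revPoly (n - 1) (monicOP μ (n - 1))

/-- The value `φ_{n-1}(e^{iθ})` for the measure with weight `w`. -/
def phiVal (w : ℝ → ℝ) (n : ℕ) (θ : ℝ) : ℂ :=
  (orthonormalOP (weightMeasure w) (n - 1)).eval (expi θ)

/-- The value `φ_{n-1}^*(e^{iθ})` for the measure with weight `w`. -/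
def phiStarVal (w : ℝ → ℝ) (n : ℕ) (θ : ℝ) : ℂ :=
  (revPoly (n - 1) (orthonormalOP (weightMeasure w) (n - 1))).eval (expi θ)

/-- `G_n(z) = i ∫ |φ_{n-1}^*(e^{iθ})|² w'(θ) / (z - e^{iθ}) dθ/2π`. -/
def G (w : ℝ → ℝ) (n : ℕ) (z : ℂ) : ℂ :=
  Complex.I * ((1 / (2 * Real.pi)) * ∫ θ in (0 : ℝ)..(2 * Real.pi),
    ((‖phiStarVal w n θ‖ ^ 2 : ℝ) : ℂ) * ((deriv w θ : ℝ) : ℂ) / (z - expi θ))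

/-- `D_n(z) = -i z ∫ φ_{n-1}^*(e^{iθ})² w'(θ) / ((z - e^{iθ}) e^{inθ}) dθ/2π`. -/
def D (w : ℝ → ℝ) (n : ℕ) (z : ℂ) : ℂ :=
  -Complex.I * z * ((1 / (2 * Real.pi)) * ∫ θ in (0 : ℝ)..(2 * Real.pi),
    phiStarVal w n θ ^ 2 * ((deriv w θ : ℝ) : ℂ) / ((z - expi θ) * expi θ ^ (n : ℤ)))

/-- `J_n(z) = i ∫ φ_{n-1}(e^{iθ})² w'(θ) / ((z - e^{iθ}) e^{i(n-2)θ}) dθ/2π`. -/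
def J (w : ℝ → ℝ) (n : ℕ) (z : ℂ) : ℂ :=
  Complex.I * ((1 / (2 * Real.pi)) * ∫ θ in (0 : ℝ)..(2 * Real.pi),
    phiVal w n θ ^ 2 * ((deriv w θ : ℝ) : ℂ) / ((z - expi θ) * expi θ ^ ((n : ℤ) - 2)))

/-- `n (1 - conj y α_{n-1}) + z G_n(z) + conj y D_n(z)`, the first bracket in `h_n(z; x; y)`. -/
def hFst (w : ℝ → ℝ) (n : ℕ) (y z : ℂ) : ℂ :=
  n * (1 - starRingEnd ℂ y * verblunsky (weightMeasure w) (n - 1)) + z * G w n z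
    + starRingEnd ℂ y * D w n z

/-- `z (J_n(z) - conj y G_n(z))`, the second term in `h_n(z; x; y)`. -/
def hSnd (w : ℝ → ℝ) (n : ℕ) (y z : ℂ) : ℂ :=
  z * (J w n z - starRingEnd ℂ y * G w n z)

/-- `h_n(z; x; y)`, with the variable `z` last. -/
def h (w : ℝ → ℝ) (n : ℕ) (x y z : ℂ) : ℂ :=
  starRingEnd ℂ x * hFst w n y z - hSnd w n y z

/-- The Wronskian `W[f, g] = f g' - g f'`. -/
def wronskian (f g : ℂ → ℂ) (z : ℂ) : ℂ := f z * deriv g z - g z * deriv f z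

/-- For `b ≠ 0` the factor `conj b` cancels from `W[h_n(z; b; y), h_n(z; -b; y)] / (2 conj b)`;
the right-hand side makes sense, and depends continuously on `b = y`, at `0` as well. -/
theorem wronskian_h_div (w : ℝ → ℝ) (n : ℕ) (b y z : ℂ) (hb : b ≠ 0)
    (h1 : DifferentiableAt ℂ (hFst w n y) z) (h2 : DifferentiableAt ℂ (hSnd w n y) z) :
    wronskian (h w n b y) (h w n (-b) y) z / (2 * starRingEnd ℂ b)
      = wronskian (hSnd w n y) (hFst w n y) z := by
  have hb' : starRingEnd ℂ b ≠ 0 := by simpa using hb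
  have key : ∀ x : ℂ, deriv (h w n x y) z
      = starRingEnd ℂ x * deriv (hFst w n y) z - deriv (hSnd w n y) z := fun x =>
    (((h1.hasDerivAt).const_mul (starRingEnd ℂ x)).sub h2.hasDerivAt).deriv
  rw [div_eq_iff (by simpa using hb)]
  simp only [wronskian, key, h, map_neg]
  ring

/-- The quotient `W[h_n(z; β; β), h_n(z; -β; β)] / (2 conj β)`. At `β = 0` both sides of the
fraction vanish identically, and the quotient means its continuous extension in `β`, which is
`W[z J_n(z), n + z G_n(z)]`, see `wronskian_h_div`. -/
def wronskianQuotient (w : ℝ → ℝ) (n : ℕ) (β z : ℂ) : ℂ :=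
  if β = 0 then wronskian (fun s => s * J w n s) (fun s => n + s * G w n s) z
  else wronskian (h w n β β) (h w n (-β) β) z / (2 * starRingEnd ℂ β)

/-- The coefficient of `y'` in the differential equation. -/
def coeffOne (w : ℝ → ℝ) (n : ℕ) (β z : ℂ) : ℂ :=
  (1 - n) / z - deriv (h w n β β) z / h w n β β z

/-- The coefficient of `y` in the differential equation. -/
def coeffZero (w : ℝ → ℝ) (n : ℕ) (β z : ℂ) : ℂ :=
  wronskianQuotient w n β z / (z * h w n β β z)
    - 1 / z * ((n + z * G w n z) * G w n z
      + J w n z * (D w n z - n * verblunsky (weightMeasure w) (n - 1)))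

/-- `U` is a domain (of the Riemann sphere, with the point `∞` removed if it is there) that
contains zero and `l` is the filter of punctured neighbourhoods of zero, or `U` contains a
neighbourhood of infinity and `l` is the filter of punctured neighbourhoods of infinity. -/
def IsDomainAt (U : Set ℂ) (l : Filter ℂ) : Prop :=
  IsOpen U ∧ IsConnected U ∧
    ((0 ∈ U ∧ l = 𝓝[≠] (0 : ℂ)) ∨ (U ∈ Bornology.cobounded ℂ ∧ l = Bornology.cobounded ℂ))

end OPUC

end

noncomputable section

namespace OPUC

/-! ### The unit circle -/

/-! Write N = n - 1, Φ = Φ_N, Ψ = Φ_N^*. The heart is a first-order linear system for (Φ, Ψ) whose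
coefficients are built from G, D, J and the Verblunsky coefficient (`monicOP_system`).

For fixed z let S(ζ) = (Ψ(z) ζΦ(ζ) - zΦ(z) Ψ(ζ)) / (ζ - z), the Christoffel–Darboux polynomial. It
reproduces: ∫ p S ζ^{-N} dμ = p(z) ‖Φ‖² for deg p ≤ N. Integrate by parts in θ the functions
ΦSζ^{-N} and ΨSζ^{-(N+1)} against w'. On the side carrying w, reproduction and orthogonality leave
only zΦ'(z) - NΦ(z), respectively Ψ'(z) - (N+1)αΦ(z). On the side carrying w', insert (z - ζ)/(z -
ζ): the numerator (z - ζ)S is an explicit combination of ζΦ and Ψ, so Cauchy transforms of ΦΨ, ζΦ²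
and Ψ² appear, which are G, J and D up to normalization.

With y = zΦ - conj β Ψ, the system gives z y' = F y + H Ψ, where F = `hFst` and H = h_n(z; β; β).
Differentiating once and eliminating Ψ, which requires H ≠ 0, yields the second-order equation. The
continued version is the identity theorem for the meromorphic function y'' + P y' + Q y. -/

theorem norm_expi (θ : ℝ) : ‖expi θ‖ = 1 := by
  simp [expi, mul_comm Complex.I, Complex.norm_exp_ofReal_mul_I]

theorem expi_ne_zero (θ : ℝ) : expi θ ≠ 0 := Complex.exp_ne_zero _

theorem star_expi (θ : ℝ) : starRingEnd ℂ (expi θ) = (expi θ)⁻¹ := by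
  rw [Complex.inv_def, Complex.normSq_eq_norm_sq, norm_expi]
  simp

theorem hasDerivAt_expi (θ : ℝ) : HasDerivAt expi (Complex.I * expi θ) θ := by
  have h1 : HasDerivAt (fun t : ℝ => Complex.I * (t : ℂ)) Complex.I θ := by
    simpa using (Complex.ofRealCLM.hasDerivAt (x := θ)).const_mul Complex.I
  have h2 := h1.cexp
  rw [mul_comm] at h2
  exact h2

theorem continuous_expi : Continuous expi := by
  unfold expi
  fun_prop

theorem expi_two_pi : expi (2 * Real.pi) = expi 0 := by
  simp [expi, mul_comm Complex.I, Complex.exp_two_pi_mul_I]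

/-- The function `θ ↦ p(e^{iθ}) e^{-imθ}`. -/
def laurentVal (m : ℕ) (p : ℂ[X]) (θ : ℝ) : ℂ := p.eval (expi θ) * (expi θ ^ m)⁻¹

theorem continuous_laurentVal (m : ℕ) (p : ℂ[X]) : Continuous (laurentVal m p) := by
  unfold laurentVal
  exact (p.continuous.comp continuous_expi).mul
    ((continuous_expi.pow m).inv₀ fun θ => pow_ne_zero _ (expi_ne_zero θ))

theorem exists_norm_eval_expi_le (p : ℂ[X]) : ∃ B : ℝ, ∀ θ, ‖p.eval (expi θ)‖ ≤ B := by
  obtain ⟨B, hB⟩ := (isCompact_sphere (0 : ℂ) 1).exists_bound_of_continuousOn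
    p.continuous.continuousOn
  exact ⟨B, fun θ => hB _ (by simp [norm_expi])⟩

theorem integrable_laurentVal (μ : Measure ℝ) [IsFiniteMeasure μ] (m : ℕ) (p : ℂ[X]) :
    Integrable (laurentVal m p) μ := by
  obtain ⟨B, hB⟩ := exists_norm_eval_expi_le p
  refine Integrable.of_bound (continuous_laurentVal m p).aestronglyMeasurable B
    (Eventually.of_forall fun θ => ?_)
  simpa [laurentVal, norm_expi] using hB θ

/-- The linear functional `p ↦ ∫ p(e^{iθ}) e^{-imθ} dμ(θ)`. -/
def moment (μ : Measure ℝ) [IsFiniteMeasure μ] (m : ℕ) : ℂ[X] →ₗ[ℂ] ℂ where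
  toFun p := ∫ θ, laurentVal m p θ ∂μ
  map_add' p q := by
    rw [← integral_add (integrable_laurentVal μ m p) (integrable_laurentVal μ m q)]
    simp [laurentVal, add_mul]
  map_smul' a p := by
    rw [RingHom.id_apply, smul_eq_mul, ← integral_const_mul]
    simp [laurentVal, mul_assoc]

theorem moment_C_mul (μ : Measure ℝ) [IsFiniteMeasure μ] (m : ℕ) (a : ℂ) (p : ℂ[X]) :
    moment μ m (C a * p) = a * moment μ m p := by
  rw [← smul_eq_C_mul, map_smul, smul_eq_mul]

theorem moment_succ_X_mul (μ : Measure ℝ) [IsFiniteMeasure μ] (m : ℕ) (p : ℂ[X]) :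
    moment μ (m + 1) (X * p) = moment μ m p := by
  refine integral_congr_ae (Eventually.of_forall fun θ => ?_)
  have := expi_ne_zero θ
  simp only [laurentVal, eval_mul, eval_X]
  field_simp
  ring

/-! ### Reversed polynomials -/

theorem natDegree_revPoly_le {N : ℕ} {p : ℂ[X]} (hp : p.natDegree ≤ N) :
    (revPoly N p).natDegree ≤ N := by
  refine natDegree_reflect_le.trans (max_le le_rfl ?_)
  exact natDegree_map_le.trans hp

theorem coeff_revPoly {N k : ℕ} (hk : k ≤ N) (p : ℂ[X]) :
    (revPoly N p).coeff k = starRingEnd ℂ (p.coeff (N - k)) := by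
  rw [revPoly, coeff_reflect, revAt_le hk, coeff_map]

theorem revPoly_revPoly (N : ℕ) (p : ℂ[X]) : revPoly N (revPoly N p) = p := by
  ext k
  simp [revPoly, coeff_reflect]

theorem revPoly_C_mul (N : ℕ) (a : ℂ) (p : ℂ[X]) :
    revPoly N (C a * p) = C (starRingEnd ℂ a) * revPoly N p := by
  simp [revPoly, reflect_C_mul]

theorem eval_revPoly {N : ℕ} {p : ℂ[X]} (hp : p.natDegree ≤ N) (θ : ℝ) :
    (revPoly N p).eval (expi θ) = expi θ ^ N * starRingEnd ℂ (p.eval (expi θ)) := by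
  have h0 := expi_ne_zero θ
  let _ : Invertible (expi θ)⁻¹ := invertibleOfNonzero (inv_ne_zero h0)
  have h := eval₂_reflect_mul_pow (RingHom.id ℂ) (expi θ)⁻¹ N (p.map (starRingEnd ℂ))
    (natDegree_map_le.trans hp)
  rw [invOf_eq_inv, inv_inv, ← star_expi, eval₂_id, eval₂_id, eval_map, eval₂_at_apply,
    star_expi] at h
  rw [revPoly, ← h, mul_left_comm, inv_pow, mul_inv_cancel₀ (pow_ne_zero _ h0), mul_one]

theorem star_eval_revPoly {N : ℕ} {p : ℂ[X]} (hp : p.natDegree ≤ N) (θ : ℝ) :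
    starRingEnd ℂ ((revPoly N p).eval (expi θ)) = (expi θ ^ N)⁻¹ * p.eval (expi θ) := by
  rw [eval_revPoly hp, map_mul, map_pow, star_expi, Complex.conj_conj, inv_pow]

/-! ### The pairing -/

/-- On the circle conj q = ζ^{-N} q^*. This trades the sesquilinear pairing for a linear functional
of one polynomial, so that later computations reduce to polynomial identities. -/
theorem pairing_eq_moment (μ : Measure ℝ) [IsFiniteMeasure μ] {N : ℕ} (p : ℂ[X]) {q : ℂ[X]}
    (hq : q.natDegree ≤ N) : pairing μ p q = moment μ N (p * revPoly N q) := by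
  refine integral_congr_ae (Eventually.of_forall fun θ => ?_)
  have := expi_ne_zero θ
  simp only [laurentVal, eval_mul, eval_revPoly hq]
  field_simp

theorem pairing_revPoly (μ : Measure ℝ) [IsFiniteMeasure μ] {N : ℕ} (p : ℂ[X]) {q : ℂ[X]}
    (hq : q.natDegree ≤ N) : pairing μ p (revPoly N q) = moment μ N (p * q) := by
  rw [pairing_eq_moment μ p (natDegree_revPoly_le hq), revPoly_revPoly]

theorem pairing_symm (μ : Measure ℝ) (p q : ℂ[X]) :
    starRingEnd ℂ (pairing μ p q) = pairing μ q p := by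
  rw [pairing, ← integral_conj]
  simp [pairing, mul_comm]

theorem pairing_add_left (μ : Measure ℝ) [IsFiniteMeasure μ] (p q r : ℂ[X]) :
    pairing μ (p + q) r = pairing μ p r + pairing μ q r := by
  simp only [pairing_eq_moment μ _ le_rfl, add_mul, map_add]

theorem pairing_sub_left (μ : Measure ℝ) [IsFiniteMeasure μ] (p q r : ℂ[X]) :
    pairing μ (p - q) r = pairing μ p r - pairing μ q r := by
  simp only [pairing_eq_moment μ _ le_rfl, sub_mul, map_sub]

theorem pairing_C_mul_left (μ : Measure ℝ) [IsFiniteMeasure μ] (a : ℂ) (p r : ℂ[X]) :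
    pairing μ (C a * p) r = a * pairing μ p r := by
  simp only [pairing_eq_moment μ _ le_rfl, mul_assoc, moment_C_mul]

theorem pairing_sum_left (μ : Measure ℝ) [IsFiniteMeasure μ] {ι : Type*} (s : Finset ι)
    (f : ι → ℂ[X]) (r : ℂ[X]) : pairing μ (∑ i ∈ s, f i) r = ∑ i ∈ s, pairing μ (f i) r := by
  simp only [pairing_eq_moment μ _ le_rfl, Finset.sum_mul, map_sum]

theorem pairing_add_right (μ : Measure ℝ) [IsFiniteMeasure μ] (p q r : ℂ[X]) :
    pairing μ r (p + q) = pairing μ r p + pairing μ r q := by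
  rw [← pairing_symm, pairing_add_left, map_add, pairing_symm, pairing_symm]

theorem pairing_X_mul_X_mul (μ : Measure ℝ) (p q : ℂ[X]) :
    pairing μ (X * p) (X * q) = pairing μ p q := by
  refine integral_congr_ae (Eventually.of_forall fun θ => ?_)
  have := expi_ne_zero θ
  simp only [eval_mul, eval_X, map_mul, star_expi]
  field_simp

theorem pairing_self (μ : Measure ℝ) (p : ℂ[X]) :
    pairing μ p p = ((∫ θ, ‖p.eval (expi θ)‖ ^ 2 ∂μ : ℝ) : ℂ) := by
  rw [pairing, ← integral_complex_ofReal]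
  refine integral_congr_ae (Eventually.of_forall fun θ => ?_)
  simp [Complex.mul_conj, Complex.normSq_eq_norm_sq]

/-! ### Orthogonal polynomials -/

theorem monicOP_degree (μ : Measure ℝ) (n : ℕ) :
    (monicOP μ n).Monic ∧ (monicOP μ n).natDegree = n := by
  induction n using Nat.strong_induction_on with
  | _ n ih =>
    have hd : (∑ k : Fin n, C (pairing μ (X ^ n) (monicOP μ k) /
        pairing μ (monicOP μ k) (monicOP μ k)) * monicOP μ k).degree < (n : ℕ) := by
      refine (degree_sum_le _ _).trans_lt ((Finset.sup_lt_iff (WithBot.bot_lt_coe n)).2 ?_)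
      intro k _
      have hk : (monicOP μ k).degree < (n : ℕ) := by
        rw [degree_eq_natDegree (ih k k.2).1.ne_zero, (ih k k.2).2]
        exact_mod_cast k.2
      rw [← smul_eq_C_mul]
      exact (degree_smul_le _ _).trans_lt hk
    rw [monicOP]
    refine ⟨monic_X_pow_sub hd, natDegree_eq_of_degree_eq_some ?_⟩
    rw [degree_sub_eq_left_of_degree_lt (by rwa [degree_X_pow]), degree_X_pow]

/-- A measure of infinite support: no nonzero polynomial vanishes almost everywhere. -/
def NontrivialMeasure (μ : Measure ℝ) : Prop := ∀ p : ℂ[X], p ≠ 0 → pairing μ p p ≠ 0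

theorem pairing_monicOP_self_ne_zero {μ : Measure ℝ} (hμ : NontrivialMeasure μ) (n : ℕ) :
    pairing μ (monicOP μ n) (monicOP μ n) ≠ 0 :=
  hμ _ (monicOP_degree μ n).1.ne_zero

theorem pairing_monicOP_of_lt {μ : Measure ℝ} [IsFiniteMeasure μ] (hμ : NontrivialMeasure μ) (n : ℕ) :
    ∀ k < n, pairing μ (monicOP μ n) (monicOP μ k) = 0 := by
  induction n using Nat.strong_induction_on with
  | _ n ih =>
    intro k hk
    -- Only the k-th projection meets Φ_k, by orthogonality at lower indices, and its coefficient is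
    -- chosen to cancel the pairing of X^n with Φ_k.
    rw [monicOP, pairing_sub_left, pairing_sum_left, Finset.sum_eq_single ⟨k, hk⟩,
      pairing_C_mul_left, div_mul_cancel₀ _ (pairing_monicOP_self_ne_zero hμ k), sub_self]
    · intro j _ hj
      have hjk : (j : ℕ) ≠ k := fun h => hj (Fin.ext h)
      rw [pairing_C_mul_left]
      rcases lt_or_gt_of_ne hjk with h | h
      · rw [← pairing_symm μ (monicOP μ k), ih k hk j h, map_zero, mul_zero]
      · rw [ih j j.2 k h, mul_zero]
    · simp

/-- If `natDegree q ≤ m`, subtracting `q_m Φ_m` lowers the degree. -/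
theorem degree_sub_coeff_mul_monicOP_lt (μ : Measure ℝ) {m : ℕ} {q : ℂ[X]}
    (hq : q.natDegree ≤ m) : (q - C (q.coeff m) * monicOP μ m).degree < (m : ℕ) := by
  rw [degree_lt_iff_coeff_zero]
  intro k hk
  obtain ⟨h1, h2⟩ := monicOP_degree μ m
  have h3 : (monicOP μ m).coeff m = 1 := by simpa [h2] using h1.coeff_natDegree
  rcases hk.eq_or_lt with rfl | hk
  · simp [h3]
  · rw [coeff_sub, coeff_C_mul, coeff_eq_zero_of_natDegree_lt (hq.trans_lt hk),
      coeff_eq_zero_of_natDegree_lt (p := monicOP μ m) (by omega)]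
    simp

theorem pairing_monicOP_of_degree_lt {μ : Measure ℝ} [IsFiniteMeasure μ] (hμ : NontrivialMeasure μ)
    (n : ℕ) (q : ℂ[X]) (hq : q.degree < (n : ℕ)) : pairing μ q (monicOP μ n) = 0 := by
  have key : ∀ m ≤ n, ∀ q : ℂ[X], q.degree < (m : ℕ) → pairing μ q (monicOP μ n) = 0 := by
    intro m
    induction m with
    | zero =>
      intro _ q hq
      have : q = 0 := by simpa [degree_lt_iff_coeff_zero, Polynomial.ext_iff] using hq
      simp [this, pairing]
    | succ m ih =>
      intro hm q hq
      have hq' : q.natDegree ≤ m := by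
        rw [natDegree_le_iff_coeff_eq_zero]
        exact fun k hk => (degree_lt_iff_coeff_zero q (m + 1)).1 hq k hk
      have h1 := ih (by omega) _ (degree_sub_coeff_mul_monicOP_lt μ hq')
      rw [pairing_sub_left, pairing_C_mul_left, ← pairing_symm μ (monicOP μ n) (monicOP μ m),
        pairing_monicOP_of_lt hμ n m (by omega)] at h1
      simpa using h1
  exact key n le_rfl q hq

theorem pairing_monicOP_right {μ : Measure ℝ} [IsFiniteMeasure μ] (hμ : NontrivialMeasure μ)
    {n : ℕ} {q : ℂ[X]} (hq : q.natDegree ≤ n) :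
    pairing μ q (monicOP μ n) = q.coeff n * pairing μ (monicOP μ n) (monicOP μ n) := by
  have h := pairing_monicOP_of_degree_lt hμ n _ (degree_sub_coeff_mul_monicOP_lt μ hq)
  rwa [pairing_sub_left, pairing_C_mul_left, sub_eq_zero] at h

theorem star_pairing_self (μ : Measure ℝ) (p : ℂ[X]) :
    starRingEnd ℂ (pairing μ p p) = pairing μ p p := pairing_symm μ p p

/-- `∫ s(ζ) ζ^{-n} Φ_n^*(ζ) dμ` picks out the leading coefficient of `s`. -/
theorem moment_mul_revPoly_monicOP {μ : Measure ℝ} [IsFiniteMeasure μ] (hμ : NontrivialMeasure μ)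
    {n : ℕ} {s : ℂ[X]} (hs : s.natDegree ≤ n) :
    moment μ n (s * revPoly n (monicOP μ n))
      = s.coeff n * pairing μ (monicOP μ n) (monicOP μ n) := by
  rw [← pairing_eq_moment μ s (monicOP_degree μ n).2.le, pairing_monicOP_right hμ hs]

/-- `∫ s(ζ) ζ^{-n} Φ_n(ζ) dμ` picks out the constant coefficient of `s`. -/
theorem moment_mul_monicOP {μ : Measure ℝ} [IsFiniteMeasure μ] (hμ : NontrivialMeasure μ)
    {n : ℕ} {s : ℂ[X]} (hs : s.natDegree ≤ n) :
    moment μ n (s * monicOP μ n)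
      = s.coeff 0 * pairing μ (monicOP μ n) (monicOP μ n) := by
  rw [mul_comm, ← pairing_revPoly μ _ hs, ← pairing_symm,
    pairing_monicOP_right hμ (natDegree_revPoly_le hs), map_mul, star_pairing_self,
    coeff_revPoly le_rfl]
  simp

theorem coeff_zero_revPoly_monicOP (μ : Measure ℝ) (n : ℕ) :
    (revPoly n (monicOP μ n)).coeff 0 = 1 := by
  obtain ⟨h1, h2⟩ := monicOP_degree μ n
  have h3 : (monicOP μ n).coeff n = 1 := by simpa [h2] using h1.coeff_natDegree
  simp [coeff_revPoly, h3]

/-- The Verblunsky coefficient as an integral. -/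
theorem moment_succ_revPoly_monicOP {μ : Measure ℝ} [IsFiniteMeasure μ] (hμ : NontrivialMeasure μ)
    (n : ℕ) : moment μ (n + 1) (revPoly n (monicOP μ n))
      = verblunsky μ n * pairing μ (monicOP μ n) (monicOP μ n) := by
  obtain ⟨hm, hd⟩ := monicOP_degree μ n
  obtain ⟨hm', hd'⟩ := monicOP_degree μ (n + 1)
  have hΨ : (revPoly n (monicOP μ n)).natDegree ≤ n := natDegree_revPoly_le hd.le
  set Φ := monicOP μ n
  set Ψ := revPoly n Φ with hΨdef
  -- Pairing q with Ψ in two ways gives the claim without the full Szegő recursion: the leading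
  -- terms of q cancel, so it has degree at most n and the pairing is q(0) ‖Φ‖²; termwise, Φ_{n+1}
  -- is orthogonal to Ψ and only the pairing of XΦ with Ψ remains.
  set q := monicOP μ (n + 1) - X * Φ with hq
  have hqd : q.natDegree ≤ n := by
    rw [natDegree_le_iff_coeff_eq_zero]
    intro k hk
    obtain ⟨j, rfl⟩ : ∃ j, k = j + 1 := ⟨k - 1, by omega⟩
    rw [hq, coeff_sub, coeff_X_mul]
    rcases (show n ≤ j by omega).eq_or_lt with rfl | hj
    · have h1 : (monicOP μ (n + 1)).coeff (n + 1) = 1 := by simpa [hd'] using hm'.coeff_natDegree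
      have h2 : Φ.coeff n = 1 := by simpa [hd] using hm.coeff_natDegree
      rw [h1, h2, sub_self]
    · rw [coeff_eq_zero_of_natDegree_lt (by omega), coeff_eq_zero_of_natDegree_lt (by omega),
        sub_zero]
  have hq0 : q.coeff 0 = (monicOP μ (n + 1)).eval 0 := by
    simp [hq, coeff_zero_eq_eval_zero]
  have h1 : pairing μ q Ψ = (monicOP μ (n + 1)).eval 0 * pairing μ Φ Φ := by
    rw [pairing_revPoly μ q hd.le, moment_mul_monicOP hμ hqd, hq0]
  have h2 : pairing μ (monicOP μ (n + 1)) Ψ = 0 := by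
    rw [← pairing_symm, pairing_monicOP_of_degree_lt hμ, map_zero]
    exact degree_le_natDegree.trans_lt (by exact_mod_cast Nat.lt_succ_of_le hΨ)
  have h3 : pairing μ (X * Φ) Ψ = starRingEnd ℂ (moment μ (n + 1) Ψ) := by
    -- Since Ψ(0) = 1, the pairing of XΦ with Ψ splits into that of Φ with a polynomial of degree
    -- below n (or zero), which vanishes, and that of XΦ with 1.
    have hΨX : Ψ = X * Ψ.divX + 1 := by
      rw [← map_one C, ← coeff_zero_revPoly_monicOP μ n]
      exact (X_mul_divX_add Ψ).symm
    have h4 : pairing μ Φ Ψ.divX = 0 := by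
      rw [← pairing_symm, pairing_monicOP_right hμ (natDegree_divX_le.trans hΨ),
        coeff_divX, coeff_eq_zero_of_natDegree_lt (by omega)]
      simp
    conv_lhs => rw [hΨX]
    rw [pairing_add_right, pairing_X_mul_X_mul, h4, zero_add, pairing, moment]
    simp only [LinearMap.coe_mk, AddHom.coe_mk]
    rw [← integral_conj]
    refine integral_congr_ae (Eventually.of_forall fun θ => ?_)
    have := expi_ne_zero θ
    simp only [laurentVal, map_mul, star_eval_revPoly hd.le, hΨdef, map_inv₀, map_pow, star_expi,
      inv_pow, inv_inv, eval_mul, eval_X, eval_one, map_one]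
    field_simp
    ring
  rw [hq, pairing_sub_left, h2, h3, zero_sub] at h1
  rw [verblunsky, neg_mul, ← star_pairing_self μ Φ, ← map_mul, ← h1]
  simp

/-! ### Integrals against the weight -/

/-- A nonnegative periodic continuous weight, differentiable with integrable derivative. -/
structure IsWeight (w : ℝ → ℝ) : Prop where
  cont : ContinuousOn w (Set.Icc 0 (2 * Real.pi))
  per : w 0 = w (2 * Real.pi)
  nonneg : ∀ θ ∈ Set.Icc 0 (2 * Real.pi), 0 ≤ w θ
  diff : ∀ θ ∈ Set.Ioo 0 (2 * Real.pi), DifferentiableAt ℝ w θ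
  int : IntegrableOn (deriv w) (Set.Ioo 0 (2 * Real.pi))

theorem IsWeight.intervalIntegrable_deriv {w : ℝ → ℝ} (hw : IsWeight w) :
    IntervalIntegrable (fun θ => ((deriv w θ : ℝ) : ℂ)) volume 0 (2 * Real.pi) := by
  rw [intervalIntegrable_iff_integrableOn_Ioo_of_le Real.two_pi_pos.le]
  exact hw.int.ofReal

theorem integral_weightMeasure {w : ℝ → ℝ} (hw : IsWeight w) (f : ℝ → ℂ) :
    ∫ θ, f θ ∂(weightMeasure w)
      = (1 / (2 * Real.pi)) * ∫ θ in (0 : ℝ)..(2 * Real.pi), f θ * (w θ : ℂ) := by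
  have hm : AEMeasurable w (volume.restrict (Set.Ico 0 (2 * Real.pi))) :=
    (hw.cont.mono Set.Ico_subset_Icc_self).aemeasurable measurableSet_Ico
  rw [weightMeasure, integral_withDensity_eq_integral_toReal_smul₀
      (hm.div_const _).ennreal_ofReal (Eventually.of_forall fun θ => ENNReal.ofReal_lt_top),
    intervalIntegral.integral_of_le Real.two_pi_pos.le, ← integral_Ico_eq_integral_Ioc,
    ← integral_const_mul]
  refine setIntegral_congr_fun measurableSet_Ico fun θ hθ => ?_
  have h0 : 0 ≤ w θ / (2 * Real.pi) :=
    div_nonneg (hw.nonneg θ (Set.Ico_subset_Icc_self hθ)) Real.two_pi_pos.le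
  simp only [ENNReal.toReal_ofReal h0, Complex.real_smul]
  push_cast
  ring

/-- A nonzero polynomial vanishes at `expi θ` for only countably many θ, a null set for an
absolutely continuous measure; were the polynomial also zero almost everywhere, the total mass would
be 0 rather than 1. -/
theorem nontrivial_weightMeasure (w : ℝ → ℝ) [IsProbabilityMeasure (weightMeasure w)] :
    NontrivialMeasure (weightMeasure w) := by
  intro p hp h0
  rw [pairing_self, Complex.ofReal_eq_zero, integral_eq_zero_iff_of_nonneg
    (fun θ => by positivity)] at h0
  · have hac : weightMeasure w ≪ volume :=
      (withDensity_absolutelyContinuous _ _).trans Measure.absolutelyContinuous_restrict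
    have hcount : {θ : ℝ | p.eval (expi θ) = 0}.Countable := by
      have h1 : {θ : ℝ | p.eval (expi θ) = 0} = ⋃ z ∈ p.roots.toFinset, expi ⁻¹' {z} := by
        ext θ
        simp [hp]
      rw [h1]
      refine p.roots.toFinset.countable_toSet.biUnion fun z _ => ?_
      rcases (expi ⁻¹' {z}).eq_empty_or_nonempty with h | ⟨t, ht⟩
      · simp [h]
      · refine (Set.countable_range fun k : ℤ => t + k * (2 * Real.pi)).mono ?_
        intro θ hθ
        have h2 : Complex.exp (Complex.I * θ) = Complex.exp (Complex.I * t) :=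
          (hθ : expi θ = z).trans (ht : expi t = z).symm
        obtain ⟨k, hk⟩ := Complex.exp_eq_exp_iff_exists_int.1 h2
        refine ⟨k, ?_⟩
        have h3 : Complex.I * (θ : ℂ) = Complex.I * ((t + k * (2 * Real.pi) : ℝ) : ℂ) := by
          rw [hk]
          push_cast
          ring
        exact_mod_cast (mul_left_cancel₀ Complex.I_ne_zero h3).symm
    have hnull : weightMeasure w {θ : ℝ | p.eval (expi θ) = 0} = 0 :=
      hac (hcount.measure_zero volume)
    have hfull : weightMeasure w {θ : ℝ | p.eval (expi θ) = 0}ᶜ = 0 := by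
      rw [EventuallyEq, ae_iff] at h0
      convert h0 using 3
      ext θ
      simp
    have huniv := measure_union_le (μ := weightMeasure w) {θ : ℝ | p.eval (expi θ) = 0}
      {θ : ℝ | p.eval (expi θ) = 0}ᶜ
    rw [Set.union_compl_self, hnull, hfull, measure_univ] at huniv
    simp at huniv
  · obtain ⟨B, hB⟩ := exists_norm_eval_expi_le p
    refine Integrable.of_bound
      (((p.continuous.comp continuous_expi).norm.pow 2).aestronglyMeasurable) (B ^ 2)
      (Eventually.of_forall fun θ => ?_)
    rw [norm_pow, norm_norm]
    exact pow_le_pow_left₀ (norm_nonneg _) (hB θ) 2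

theorem hasDerivAt_laurentVal (m : ℕ) (p : ℂ[X]) (θ : ℝ) :
    HasDerivAt (laurentVal m p)
      (Complex.I * laurentVal m (X * derivative p - C (m : ℂ) * p) θ) θ := by
  have h0 := expi_ne_zero θ
  have h1 : HasDerivAt (fun t => p.eval (expi t))
      ((derivative p).eval (expi θ) * (Complex.I * expi θ)) θ :=
    (p.hasDerivAt (expi θ)).comp θ (hasDerivAt_expi θ)
  have h2 := ((hasDerivAt_expi θ).fun_pow m).fun_inv (pow_ne_zero m h0)
  refine (h1.fun_mul h2).congr_deriv ?_
  simp only [laurentVal, eval_sub, eval_mul, eval_X, eval_C]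
  rcases m with _ | m
  · simp
    ring
  · push_cast
    field_simp
    ring

/-- Integration by parts against the weight. -/
theorem integral_laurentVal_mul_deriv {w : ℝ → ℝ} (hw : IsWeight w)
    [IsProbabilityMeasure (weightMeasure w)] (m : ℕ) (p : ℂ[X]) :
    Complex.I * ((1 / (2 * Real.pi)) * ∫ θ in (0 : ℝ)..(2 * Real.pi),
        laurentVal m p θ * ((deriv w θ : ℝ) : ℂ))
      = moment (weightMeasure w) m (X * derivative p - C (m : ℂ) * p) := by
  have hpi := Real.two_pi_pos
  have hcont := continuous_laurentVal m (X * derivative p - C (m : ℂ) * p)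
  rw [intervalIntegral.integral_mul_deriv_eq_deriv_mul_of_hasDerivAt
    (u := laurentVal m p) (v := fun θ => (w θ : ℂ))
    (u' := fun θ => Complex.I * laurentVal m (X * derivative p - C (m : ℂ) * p) θ)
    (continuous_laurentVal m p).continuousOn
    (by
      rw [Set.uIcc_of_le hpi.le]
      exact Complex.continuous_ofReal.comp_continuousOn hw.cont)
    (fun θ _ => hasDerivAt_laurentVal m p θ)
    (fun θ hθ => by
      rw [min_eq_left hpi.le, max_eq_right hpi.le] at hθ
      exact (hw.diff θ hθ).hasDerivAt.ofReal_comp)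
    ((continuous_const.mul hcont).intervalIntegrable _ _) hw.intervalIntegrable_deriv]
  -- Periodicity of both factors removes the boundary term. The sign from integrating by parts and
  -- the two factors i then combine to -i · i = 1.
  have hper : laurentVal m p (2 * Real.pi) = laurentVal m p 0 := by
    simp only [laurentVal, expi_two_pi]
  rw [hper, hw.per, sub_self, zero_sub]
  simp only [mul_assoc Complex.I]
  rw [intervalIntegral.integral_const_mul]
  change _ = ∫ θ, laurentVal m (X * derivative p - C (m : ℂ) * p) θ ∂(weightMeasure w)
  rw [integral_weightMeasure hw]
  linear_combination -((1 / (2 * Real.pi)) * ∫ θ in (0 : ℝ)..(2 * Real.pi),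
    laurentVal m (X * derivative p - C (m : ℂ) * p) θ * (w θ : ℂ)) * Complex.I_mul_I

/-- A Cauchy-type integral over the circle is holomorphic off the circle. -/
theorem differentiableAt_cauchy {f : ℝ → ℂ}
    (hf : IntervalIntegrable f volume 0 (2 * Real.pi)) {z : ℂ} (hz : ‖z‖ ≠ 1) :
    DifferentiableAt ℂ (fun s => ∫ θ in (0 : ℝ)..(2 * Real.pi), f θ / (s - expi θ)) z := by
  have hpi := Real.two_pi_pos
  simp only [intervalIntegral.integral_of_le hpi.le]
  rw [intervalIntegrable_iff_integrableOn_Ioc_of_le hpi.le] at hf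
  -- Half the distance from z to the circle: on the ball of this radius the denominators stay at
  -- least ε, which dominates the differentiated integrand.
  set ε := |‖z‖ - 1| / 2 with hε
  have hε0 : 0 < ε := half_pos (abs_pos.2 (sub_ne_zero.2 hz))
  have hdist : ∀ s ∈ Metric.ball z ε, ∀ θ, ε ≤ ‖s - expi θ‖ := by
    intro s hs θ
    have h1 : |‖z‖ - ‖expi θ‖| ≤ ‖z - expi θ‖ := abs_norm_sub_norm_le _ _
    rw [norm_expi] at h1
    have h2 : ‖z - expi θ‖ ≤ ‖z - s‖ + ‖s - expi θ‖ := norm_sub_le_norm_sub_add_norm_sub _ _ _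
    rw [Metric.mem_ball, dist_comm, dist_eq_norm] at hs
    linarith
  have hne : ∀ s ∈ Metric.ball z ε, ∀ θ, s - expi θ ≠ 0 := fun s hs θ =>
    norm_pos_iff.1 (hε0.trans_le (hdist s hs θ))
  have hcont : ∀ s ∈ Metric.ball z ε, Continuous fun θ => (s - expi θ)⁻¹ := fun s hs =>
    (continuous_const.sub continuous_expi).inv₀ (hne s hs)
  have hball : Metric.ball z ε ∈ 𝓝 z := Metric.ball_mem_nhds z hε0
  have hzb : z ∈ Metric.ball z ε := Metric.mem_ball_self hε0
  refine (hasDerivAt_integral_of_dominated_loc_of_deriv_le (bound := fun θ => ‖f θ‖ * (ε⁻¹) ^ 2)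
    (F' := fun s θ => -(f θ * ((s - expi θ)⁻¹) ^ 2)) hball ?_ ?_ ?_ ?_ ?_ ?_).2.differentiableAt
  · filter_upwards [hball] with s hs
    simp only [div_eq_mul_inv]
    exact hf.aestronglyMeasurable.mul (hcont s hs).aestronglyMeasurable
  · simp only [div_eq_mul_inv]
    refine hf.mul_bdd (c := ε⁻¹) (hcont z hzb).aestronglyMeasurable (Eventually.of_forall fun θ => ?_)
    rw [norm_inv]
    exact inv_anti₀ hε0 (hdist z hzb θ)
  · exact (hf.aestronglyMeasurable.mul ((hcont z hzb).pow 2).aestronglyMeasurable).neg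
  · refine Eventually.of_forall fun θ s hs => ?_
    rw [norm_neg, norm_mul, norm_pow, norm_inv]
    gcongr
    exact hdist s hs θ
  · exact hf.norm.mul_const _
  · refine Eventually.of_forall fun θ s hs => ?_
    have h := (((hasDerivAt_id s).sub_const (expi θ)).fun_inv (hne s hs θ)).const_mul (f θ)
    refine h.congr_deriv ?_
    simp only [id, inv_pow, div_eq_mul_inv]
    ring

/-! ### The Christoffel–Darboux kernel -/

/-- The polynomial `ζ ↦ (Φ_N^*(z) ζ Φ_N(ζ) - z Φ_N(z) Φ_N^*(ζ)) / (ζ - z)`. Up to normalization,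
its product with `ζ^{-N}` is the reproducing kernel of the polynomials of degree at most `N`. -/
def cdPoly (μ : Measure ℝ) (N : ℕ) (z : ℂ) : ℂ[X] :=
  (C ((revPoly N (monicOP μ N)).eval z) * (X * monicOP μ N)
    - C (z * (monicOP μ N).eval z) * revPoly N (monicOP μ N)) /ₘ (X - C z)

theorem X_sub_C_mul_cdPoly (μ : Measure ℝ) (N : ℕ) (z : ℂ) :
    (X - C z) * cdPoly μ N z = C ((revPoly N (monicOP μ N)).eval z) * (X * monicOP μ N)
      - C (z * (monicOP μ N).eval z) * revPoly N (monicOP μ N) := by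
  refine mul_divByMonic_eq_iff_isRoot.2 ?_
  simp only [IsRoot, eval_sub, eval_mul, eval_C, eval_X]
  ring

theorem natDegree_cdPoly_le (μ : Measure ℝ) (N : ℕ) (z : ℂ) :
    (cdPoly μ N z).natDegree ≤ N := by
  have hd := (monicOP_degree μ N).2
  rw [cdPoly, natDegree_divByMonic _ (monic_X_sub_C z), natDegree_X_sub_C, Nat.sub_le_iff_le_add]
  refine (natDegree_sub_le _ _).trans (max_le ?_ ?_)
  · refine (natDegree_C_mul_le _ _).trans (natDegree_mul_le.trans ?_)
    rw [natDegree_X, hd, add_comm]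
  · exact (natDegree_C_mul_le _ _).trans ((natDegree_revPoly_le hd.le).trans (Nat.le_succ N))

theorem coeff_zero_cdPoly (μ : Measure ℝ) (N : ℕ) {z : ℂ} (hz : z ≠ 0) :
    (cdPoly μ N z).coeff 0 = (monicOP μ N).eval z := by
  have h := congrArg (fun p : ℂ[X] => p.coeff 0) (X_sub_C_mul_cdPoly μ N z)
  simp only [mul_coeff_zero, coeff_sub, coeff_X_zero, coeff_C_zero, coeff_zero_revPoly_monicOP] at h
  refine mul_left_cancel₀ (neg_ne_zero.2 hz) ?_
  linear_combination h

/-- Write p - p(z) = (ζ - z) r. Then (ζ - z) S turns the remainder into multiples of ζrΦ and rΨ.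
Both moments vanish: ζr has no constant term and r has no coefficient of degree N. -/
theorem moment_mul_cdPoly {μ : Measure ℝ} [IsFiniteMeasure μ] (hμ : NontrivialMeasure μ) {N : ℕ}
    {p : ℂ[X]} (hp : p.natDegree ≤ N) (z : ℂ) :
    moment μ N (p * cdPoly μ N z) = p.eval z * moment μ N (cdPoly μ N z) := by
  have hd := (monicOP_degree μ N).2
  obtain ⟨r, hr⟩ : (X - C z) ∣ p - C (p.eval z) := by
    rw [dvd_iff_isRoot]
    simp
  have hrN : ∀ k, N ≤ k → r.coeff k = 0 := by
    intro k hk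
    by_cases h0 : r = 0
    · simp [h0]
    have h1 : (p - C (p.eval z)).natDegree = 1 + r.natDegree := by
      rw [hr, natDegree_mul (X_sub_C_ne_zero z) h0, natDegree_X_sub_C]
    rw [natDegree_sub_C] at h1
    exact coeff_eq_zero_of_natDegree_lt (by omega)
  have hr1 : r.natDegree ≤ N :=
    natDegree_le_iff_coeff_eq_zero.2 fun k hk => hrN k (le_of_lt hk)
  have hr2 : (X * r).natDegree ≤ N := by
    rw [natDegree_le_iff_coeff_eq_zero]
    intro k hk
    obtain ⟨j, rfl⟩ : ∃ j, k = j + 1 := ⟨k - 1, by omega⟩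
    rw [coeff_X_mul]
    exact hrN j (by omega)
  have hdecomp : p * cdPoly μ N z = C (p.eval z) * cdPoly μ N z
      + (C ((revPoly N (monicOP μ N)).eval z) * ((X * r) * monicOP μ N)
        - C (z * (monicOP μ N).eval z) * (r * revPoly N (monicOP μ N))) := by
    linear_combination cdPoly μ N z * hr + r * X_sub_C_mul_cdPoly μ N z
  rw [hdecomp, map_add, map_sub, moment_C_mul, moment_C_mul, moment_C_mul,
    moment_mul_monicOP hμ hr2, moment_mul_revPoly_monicOP hμ hr1, hrN N le_rfl]
  simp

/-- Evaluate the moment of ΦS twice: the previous lemma gives Φ(z) times the moment of S, while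
orthogonality gives S(0) ‖Φ‖² = Φ(z) ‖Φ‖². Cancelling Φ(z) is the reason for assuming it nonzero. -/
theorem moment_cdPoly {μ : Measure ℝ} [IsFiniteMeasure μ] (hμ : NontrivialMeasure μ) {N : ℕ} {z : ℂ}
    (hz : z ≠ 0) (hΦ : (monicOP μ N).eval z ≠ 0) :
    moment μ N (cdPoly μ N z) = pairing μ (monicOP μ N) (monicOP μ N) := by
  have h := moment_mul_cdPoly hμ (monicOP_degree μ N).2.le z
  rw [mul_comm, moment_mul_monicOP hμ (natDegree_cdPoly_le μ N z), coeff_zero_cdPoly μ N hz] at h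
  exact (mul_left_cancel₀ hΦ h).symm

/-- The reproducing property of the Christoffel–Darboux kernel. -/
theorem moment_mul_cdPoly_eq {μ : Measure ℝ} [IsFiniteMeasure μ] (hμ : NontrivialMeasure μ) {N : ℕ}
    {p : ℂ[X]} (hp : p.natDegree ≤ N) {z : ℂ} (hz : z ≠ 0) (hΦ : (monicOP μ N).eval z ≠ 0) :
    moment μ N (p * cdPoly μ N z) = p.eval z * pairing μ (monicOP μ N) (monicOP μ N) := by
  rw [moment_mul_cdPoly hμ hp, moment_cdPoly hμ hz hΦ]

/-- By the product rule, the part with ζS'Φ dies because ζS' has no constant term; the part with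
(ζΦ' - NΦ)S is evaluated by reproduction. -/
theorem moment_deriv_monicOP_mul_cdPoly {μ : Measure ℝ} [IsFiniteMeasure μ] (hμ : NontrivialMeasure μ)
    {N : ℕ} {z : ℂ} (hz : z ≠ 0) (hΦ : (monicOP μ N).eval z ≠ 0) :
    moment μ N (X * derivative (monicOP μ N * cdPoly μ N z)
        - C (N : ℂ) * (monicOP μ N * cdPoly μ N z))
      = (z * (derivative (monicOP μ N)).eval z - N * (monicOP μ N).eval z)
        * pairing μ (monicOP μ N) (monicOP μ N) := by
  have hd := (monicOP_degree μ N).2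
  have hXd : ∀ p : ℂ[X], p.natDegree ≤ N → (X * derivative p).natDegree ≤ N := by
    intro p hp
    rw [natDegree_le_iff_coeff_eq_zero]
    intro k hk
    obtain ⟨j, rfl⟩ : ∃ j, k = j + 1 := ⟨k - 1, by omega⟩
    rw [coeff_X_mul, coeff_derivative, coeff_eq_zero_of_natDegree_lt (by omega), zero_mul]
  have hsplit : X * derivative (monicOP μ N * cdPoly μ N z)
        - C (N : ℂ) * (monicOP μ N * cdPoly μ N z)
      = (X * derivative (monicOP μ N) - C (N : ℂ) * monicOP μ N) * cdPoly μ N z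
        + (X * derivative (cdPoly μ N z)) * monicOP μ N := by
    rw [derivative_mul]
    ring
  rw [hsplit, map_add, moment_mul_monicOP hμ (hXd _ (natDegree_cdPoly_le μ N z)),
    moment_mul_cdPoly_eq hμ _ hz hΦ]
  · simp
  · exact (natDegree_sub_le _ _).trans
      (max_le (hXd _ hd.le) ((natDegree_C_mul_le _ _).trans hd.le))

/-- The extra power ζ^{-1} is absorbed by a factor ζ in every term once S is split as ζ `S.divX` +
Φ(z). Reproduction gives Ψ'(z), the terms with S' and `S.divX` vanish by degree, and the constant
Φ(z) leaves the moment of Ψ that defines α. -/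
theorem moment_deriv_revPoly_mul_cdPoly {μ : Measure ℝ} [IsFiniteMeasure μ] (hμ : NontrivialMeasure μ)
    {N : ℕ} {z : ℂ} (hz : z ≠ 0) (hΦ : (monicOP μ N).eval z ≠ 0) :
    moment μ (N + 1) (X * derivative (revPoly N (monicOP μ N) * cdPoly μ N z)
        - C ((N + 1 : ℕ) : ℂ) * (revPoly N (monicOP μ N) * cdPoly μ N z))
      = ((derivative (revPoly N (monicOP μ N))).eval z
          - (N + 1 : ℕ) * verblunsky μ N * (monicOP μ N).eval z)
        * pairing μ (monicOP μ N) (monicOP μ N) := by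
  have hS := natDegree_cdPoly_le μ N z
  have hS0 := coeff_zero_cdPoly μ N hz
  have hΨ : (revPoly N (monicOP μ N)).natDegree ≤ N :=
    natDegree_revPoly_le (monicOP_degree μ N).2.le
  have hrep := moment_mul_cdPoly_eq hμ
    ((natDegree_derivative_le (revPoly N (monicOP μ N))).trans ((Nat.sub_le _ _).trans hΨ)) hz hΦ
  have halpha := moment_succ_revPoly_monicOP hμ N
  have hdS : moment μ N (derivative (cdPoly μ N z) * revPoly N (monicOP μ N)) = 0 := by
    rw [moment_mul_revPoly_monicOP hμ ((natDegree_derivative_le _).trans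
      ((Nat.sub_le _ _).trans hS)), coeff_derivative, coeff_eq_zero_of_natDegree_lt (by omega),
      zero_mul, zero_mul]
  have hXS : moment μ N ((cdPoly μ N z).divX * revPoly N (monicOP μ N)) = 0 := by
    rw [moment_mul_revPoly_monicOP hμ (natDegree_divX_le.trans hS), coeff_divX,
      coeff_eq_zero_of_natDegree_lt (by omega), zero_mul]
  have hX := X_mul_divX_add (cdPoly μ N z)
  rw [hS0] at hX
  set Ψ := revPoly N (monicOP μ N)
  set S := cdPoly μ N z
  have hsplit : X * derivative (Ψ * S) - C ((N + 1 : ℕ) : ℂ) * (Ψ * S)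
      = X * (derivative Ψ * S) + X * (derivative S * Ψ)
        - C ((N + 1 : ℕ) : ℂ) * (X * (S.divX * Ψ))
        - C ((N + 1 : ℕ) * (monicOP μ N).eval z) * Ψ := by
    rw [derivative_mul, C_mul]
    linear_combination C ((N + 1 : ℕ) : ℂ) * Ψ * hX
  rw [hsplit, map_sub, map_sub, map_add, moment_C_mul, moment_C_mul, moment_succ_X_mul,
    moment_succ_X_mul, moment_succ_X_mul, hrep, hdS, hXS, halpha]
  ring

/-! ### The first-order system -/

/-- The Cauchy transform `i ∫ p(e^{iθ}) e^{-imθ} w'(θ) / (z - e^{iθ}) dθ/2π`. -/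
def cauchyTransform (w : ℝ → ℝ) (m : ℕ) (p : ℂ[X]) (z : ℂ) : ℂ :=
  Complex.I * ((1 / (2 * Real.pi)) * ∫ θ in (0 : ℝ)..(2 * Real.pi),
    laurentVal m p θ * ((deriv w θ : ℝ) : ℂ) / (z - expi θ))

theorem sub_expi_ne_zero {z : ℂ} (hz : ‖z‖ ≠ 1) (θ : ℝ) : z - expi θ ≠ 0 := by
  intro h
  rw [sub_eq_zero.1 h, norm_expi] at hz
  exact hz rfl

theorem differentiableAt_cauchyTransform {w : ℝ → ℝ} (hw : IsWeight w) (m : ℕ) (p : ℂ[X])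
    {z : ℂ} (hz : ‖z‖ ≠ 1) : DifferentiableAt ℂ (cauchyTransform w m p) z :=
  ((differentiableAt_cauchy (hw.intervalIntegrable_deriv.continuousOn_mul
    (continuous_laurentVal m p).continuousOn) hz).const_mul _).const_mul _

theorem cauchyTransform_lin {w : ℝ → ℝ} (hw : IsWeight w) (m : ℕ) (a b : ℂ) (p q : ℂ[X])
    {z : ℂ} (hz : ‖z‖ ≠ 1) : cauchyTransform w m (C a * p + C b * q) z
      = a * cauchyTransform w m p z + b * cauchyTransform w m q z := by
  have hint : ∀ p : ℂ[X], IntervalIntegrable (fun θ => laurentVal m p θ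
      * ((deriv w θ : ℝ) : ℂ) / (z - expi θ)) volume 0 (2 * Real.pi) := fun p => by
    simp only [div_eq_mul_inv]
    exact (hw.intervalIntegrable_deriv.continuousOn_mul
      (continuous_laurentVal m p).continuousOn).mul_continuousOn
      ((continuous_const.sub continuous_expi).inv₀ (sub_expi_ne_zero hz)).continuousOn
  have h : ∫ θ in (0 : ℝ)..(2 * Real.pi),
      laurentVal m (C a * p + C b * q) θ * ((deriv w θ : ℝ) : ℂ) / (z - expi θ)
      = a * (∫ θ in (0 : ℝ)..(2 * Real.pi),
          laurentVal m p θ * ((deriv w θ : ℝ) : ℂ) / (z - expi θ))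
        + b * ∫ θ in (0 : ℝ)..(2 * Real.pi),
          laurentVal m q θ * ((deriv w θ : ℝ) : ℂ) / (z - expi θ) := by
    rw [← intervalIntegral.integral_const_mul, ← intervalIntegral.integral_const_mul,
      ← intervalIntegral.integral_add ((hint p).const_mul a) ((hint q).const_mul b)]
    congr 1
    funext θ
    simp only [laurentVal, eval_add, eval_mul, eval_C]
    ring
  rw [cauchyTransform, cauchyTransform, cauchyTransform, h]
  ring

theorem cauchyTransform_succ_X_mul (w : ℝ → ℝ) (m : ℕ) (p : ℂ[X]) (z : ℂ) :
    cauchyTransform w (m + 1) (X * p) z = cauchyTransform w m p z := by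
  have h : laurentVal (m + 1) (X * p) = laurentVal m p := by
    funext θ
    have := expi_ne_zero θ
    simp only [laurentVal, eval_mul, eval_X]
    field_simp
    ring
  rw [cauchyTransform, h, cauchyTransform]

/-- The factor z - ζ cancels the Cauchy kernel, and integration by parts evaluates what is left. -/
theorem cauchyTransform_mul_sub {w : ℝ → ℝ} (hw : IsWeight w)
    [IsProbabilityMeasure (weightMeasure w)] (m : ℕ) (p : ℂ[X]) {z : ℂ} (hz : ‖z‖ ≠ 1) :
    cauchyTransform w m ((C z - X) * p) z
      = moment (weightMeasure w) m (X * derivative p - C (m : ℂ) * p) := by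
  rw [← integral_laurentVal_mul_deriv hw, cauchyTransform]
  congr 4
  funext θ
  have := sub_expi_ne_zero hz θ
  simp only [laurentVal, eval_mul, eval_sub, eval_X, eval_C]
  field_simp

/-- The square of the leading coefficient of the orthonormal polynomial. -/
def kappaSq (w : ℝ → ℝ) (N : ℕ) : ℂ := (((normOP (weightMeasure w) N)⁻¹ : ℝ) : ℂ) ^ 2

theorem kappaSq_mul_pairing (w : ℝ → ℝ) [IsProbabilityMeasure (weightMeasure w)] (N : ℕ) :
    kappaSq w N * pairing (weightMeasure w) (monicOP (weightMeasure w) N)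
      (monicOP (weightMeasure w) N) = 1 := by
  have h := pairing_monicOP_self_ne_zero (nontrivial_weightMeasure w) N
  rw [pairing_self] at h ⊢
  rw [kappaSq, normOP, ← Complex.ofReal_pow, inv_pow, Real.sq_sqrt
    (integral_nonneg fun θ => by positivity), ← Complex.ofReal_mul, inv_mul_cancel₀
    (by exact_mod_cast h), Complex.ofReal_one]

theorem phiVal_succ (w : ℝ → ℝ) (N : ℕ) (θ : ℝ) :
    phiVal w (N + 1) θ = (((normOP (weightMeasure w) N)⁻¹ : ℝ) : ℂ)
      * (monicOP (weightMeasure w) N).eval (expi θ) := by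
  simp [phiVal, orthonormalOP]

theorem phiStarVal_succ (w : ℝ → ℝ) (N : ℕ) (θ : ℝ) :
    phiStarVal w (N + 1) θ = (((normOP (weightMeasure w) N)⁻¹ : ℝ) : ℂ)
      * (revPoly N (monicOP (weightMeasure w) N)).eval (expi θ) := by
  rw [phiStarVal, orthonormalOP, Nat.add_sub_cancel, revPoly_C_mul, Complex.conj_ofReal, eval_mul,
    eval_C]

theorem const_mul_cauchyTransform (w : ℝ → ℝ) (m : ℕ) (p : ℂ[X]) (a z : ℂ) (F : ℝ → ℂ)
    (hF : ∀ θ, F θ = a * (laurentVal m p θ * ((deriv w θ : ℝ) : ℂ) / (z - expi θ))) :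
    Complex.I * ((1 / (2 * Real.pi)) * ∫ θ in (0 : ℝ)..(2 * Real.pi), F θ)
      = a * cauchyTransform w m p z := by
  simp only [hF, intervalIntegral.integral_const_mul, cauchyTransform]
  ring

theorem G_succ (w : ℝ → ℝ) (N : ℕ) (z : ℂ) :
    G w (N + 1) z = kappaSq w N * cauchyTransform w N
      (monicOP (weightMeasure w) N * revPoly N (monicOP (weightMeasure w) N)) z := by
  refine const_mul_cauchyTransform w N _ _ z _ fun θ => ?_
  rw [← Complex.normSq_eq_norm_sq, ← Complex.mul_conj, phiStarVal_succ, map_mul,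
    Complex.conj_ofReal, star_eval_revPoly (monicOP_degree _ N).2.le, kappaSq, laurentVal, eval_mul]
  ring

theorem D_succ (w : ℝ → ℝ) (N : ℕ) (z : ℂ) :
    D w (N + 1) z = -z * (kappaSq w N * cauchyTransform w (N + 1)
      (revPoly N (monicOP (weightMeasure w) N) ^ 2) z) := by
  rw [← const_mul_cauchyTransform w (N + 1) _ _ z (fun θ => phiStarVal w (N + 1) θ ^ 2
    * ((deriv w θ : ℝ) : ℂ) / ((z - expi θ) * expi θ ^ ((N + 1 : ℕ) : ℤ))), D]
  · ring
  · intro θ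
    rw [zpow_natCast, phiStarVal_succ, kappaSq, laurentVal, eval_pow, div_eq_mul_inv, mul_inv,
      div_eq_mul_inv]
    ring

theorem J_succ (w : ℝ → ℝ) (N : ℕ) (z : ℂ) :
    J w (N + 1) z = kappaSq w N * cauchyTransform w N
      (X * monicOP (weightMeasure w) N ^ 2) z := by
  refine const_mul_cauchyTransform w N _ _ z _ fun θ => ?_
  have h0 := expi_ne_zero θ
  -- The exponent N - 1 is negative for N = 0; moving one power of ζ to the numerator accounts for
  -- the factor `X` and keeps a natural exponent.
  have h1 : expi θ ^ (((N + 1 : ℕ) : ℤ) - 2) = expi θ ^ N * (expi θ)⁻¹ := by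
    rw [← zpow_natCast, ← zpow_neg_one, ← zpow_add₀ h0]
    congr 1
    push_cast
    ring
  rw [h1, phiVal_succ, kappaSq, laurentVal, eval_mul, eval_pow, eval_X, div_eq_mul_inv, mul_inv,
    mul_inv, inv_inv, div_eq_mul_inv]
  ring

theorem differentiableAt_G {w : ℝ → ℝ} (hw : IsWeight w) (N : ℕ) {z : ℂ} (hz : ‖z‖ ≠ 1) :
    DifferentiableAt ℂ (G w (N + 1)) z := by
  rw [funext (G_succ w N)]
  exact (differentiableAt_cauchyTransform hw _ _ hz).const_mul _

theorem differentiableAt_D {w : ℝ → ℝ} (hw : IsWeight w) (N : ℕ) {z : ℂ} (hz : ‖z‖ ≠ 1) :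
    DifferentiableAt ℂ (D w (N + 1)) z := by
  rw [funext (D_succ w N)]
  exact differentiableAt_id.neg.mul ((differentiableAt_cauchyTransform hw _ _ hz).const_mul _)

theorem differentiableAt_J {w : ℝ → ℝ} (hw : IsWeight w) (N : ℕ) {z : ℂ} (hz : ‖z‖ ≠ 1) :
    DifferentiableAt ℂ (J w (N + 1)) z := by
  rw [funext (J_succ w N)]
  exact (differentiableAt_cauchyTransform hw _ _ hz).const_mul _

theorem monicOP_system_of_eval_ne_zero {w : ℝ → ℝ} (hw : IsWeight w)
    [IsProbabilityMeasure (weightMeasure w)] (N : ℕ) {z : ℂ} (hz : ‖z‖ ≠ 1) (hz0 : z ≠ 0)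
    (hΦ : (monicOP (weightMeasure w) N).eval z ≠ 0) :
    z * (derivative (monicOP (weightMeasure w) N)).eval z
      = (N + z * G w (N + 1) z) * (monicOP (weightMeasure w) N).eval z
        - J w (N + 1) z * (revPoly N (monicOP (weightMeasure w) N)).eval z ∧
    (derivative (revPoly N (monicOP (weightMeasure w) N))).eval z
      = ((N + 1 : ℕ) * verblunsky (weightMeasure w) N - D w (N + 1) z)
          * (monicOP (weightMeasure w) N).eval z
        - G w (N + 1) z * (revPoly N (monicOP (weightMeasure w) N)).eval z := by
  have hμ := nontrivial_weightMeasure w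
  have hκ := kappaSq_mul_pairing w N
  have hS := X_sub_C_mul_cdPoly (weightMeasure w) N z
  have h1 := moment_deriv_monicOP_mul_cdPoly hμ hz0 hΦ
  have h2 := moment_deriv_revPoly_mul_cdPoly hμ hz0 hΦ
  rw [← cauchyTransform_mul_sub hw _ _ hz] at h1 h2
  rw [G_succ, J_succ, D_succ]
  set Φ := monicOP (weightMeasure w) N
  set Ψ := revPoly N Φ
  -- The defining identity of S expresses the integrand through exactly the products that occur in
  -- G, J and D.
  have e1 : (C z - X) * (Φ * cdPoly (weightMeasure w) N z)
      = C (z * Φ.eval z) * (Φ * Ψ) + C (-Ψ.eval z) * (X * Φ ^ 2) := by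
    rw [C_neg]
    linear_combination -Φ * hS
  have e2 : (C z - X) * (Ψ * cdPoly (weightMeasure w) N z)
      = C (z * Φ.eval z) * Ψ ^ 2 + C (-Ψ.eval z) * (X * (Φ * Ψ)) := by
    rw [C_neg]
    linear_combination -Ψ * hS
  rw [e1, cauchyTransform_lin hw _ _ _ _ _ hz] at h1
  rw [e2, cauchyTransform_lin hw _ _ _ _ _ hz, cauchyTransform_succ_X_mul] at h2
  constructor
  · linear_combination -kappaSq w N * h1
      - (z * (derivative Φ).eval z - N * Φ.eval z) * hκ
  · linear_combination -kappaSq w N * h2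
      - ((derivative Ψ).eval z
        - (N + 1 : ℕ) * verblunsky (weightMeasure w) N * Φ.eval z) * hκ

/-- The first-order system satisfied by `Φ_N` and `Φ_N^*`. -/
theorem monicOP_system {w : ℝ → ℝ} (hw : IsWeight w)
    [IsProbabilityMeasure (weightMeasure w)] (N : ℕ) {z : ℂ} (hz : ‖z‖ ≠ 1) (hz0 : z ≠ 0) :
    z * (derivative (monicOP (weightMeasure w) N)).eval z
      = (N + z * G w (N + 1) z) * (monicOP (weightMeasure w) N).eval z
        - J w (N + 1) z * (revPoly N (monicOP (weightMeasure w) N)).eval z ∧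
    (derivative (revPoly N (monicOP (weightMeasure w) N))).eval z
      = ((N + 1 : ℕ) * verblunsky (weightMeasure w) N - D w (N + 1) z)
          * (monicOP (weightMeasure w) N).eval z
        - G w (N + 1) z * (revPoly N (monicOP (weightMeasure w) N)).eval z := by
  have hG := (differentiableAt_G hw N hz).continuousAt
  have hD := (differentiableAt_D hw N hz).continuousAt
  have hJ := (differentiableAt_J hw N hz).continuousAt
  have hpoly : ∀ p : ℂ[X], ContinuousAt (fun s => p.eval s) z := fun p => p.continuous.continuousAt
  -- Zeros of Φ are isolated and both sides of the system are continuous off the circle, so the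
  -- restriction Φ(z) ≠ 0 is removed by a limit.
  have hroots : ∀ᶠ s in 𝓝[≠] z, (monicOP (weightMeasure w) N).eval s ≠ 0 := by
    have hfin : {s | (monicOP (weightMeasure w) N).eval s = 0}.Finite :=
      finite_setOfPred_isRoot (monicOP_degree _ N).1.ne_zero
    have hmem : ({s | (monicOP (weightMeasure w) N).eval s = 0} \ {z})ᶜ ∈ 𝓝 z :=
      (hfin.subset Set.sdiff_subset).isClosed.isOpen_compl.mem_nhds (by simp)
    filter_upwards [nhdsWithin_le_nhds hmem, self_mem_nhdsWithin] with s h1 h2 h3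
    exact h1 ⟨h3, h2⟩
  have hnorm : ∀ᶠ s in 𝓝[≠] z, ‖s‖ ≠ 1 :=
    (continuous_norm.continuousAt.eventually_ne hz).filter_mono nhdsWithin_le_nhds
  have hne : ∀ᶠ s in 𝓝[≠] z, s ≠ 0 :=
    (continuousAt_id.eventually_ne hz0).filter_mono nhdsWithin_le_nhds
  have hev := (hnorm.and (hne.and hroots)).mono fun s hs =>
    monicOP_system_of_eval_ne_zero hw N hs.1 hs.2.1 hs.2.2
  have hlim : ∀ f g : ℂ → ℂ, ContinuousAt f z → ContinuousAt g z → f =ᶠ[𝓝[≠] z] g → f z = g z :=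
    fun f g hf hg hfg => tendsto_nhds_unique_of_eventuallyEq
      (hf.tendsto.mono_left nhdsWithin_le_nhds) (hg.tendsto.mono_left nhdsWithin_le_nhds) hfg
  constructor
  · refine hlim _ _ ?_ ?_ (hev.mono fun s hs => hs.1)
    · exact continuousAt_id.mul (hpoly _)
    · exact ((continuousAt_const.add (continuousAt_id.mul hG)).mul (hpoly _)).sub
        (hJ.mul (hpoly _))
  · refine hlim _ _ (hpoly _) ?_ (hev.mono fun s hs => hs.2)
    exact ((continuousAt_const.sub hD).mul (hpoly _)).sub (hG.mul (hpoly _))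

/-! ### The second-order equation -/

theorem differentiableAt_hFst {w : ℝ → ℝ} (hw : IsWeight w) (N : ℕ) (y : ℂ) {z : ℂ}
    (hz : ‖z‖ ≠ 1) : DifferentiableAt ℂ (hFst w (N + 1) y) z :=
  ((differentiableAt_const _).add (differentiableAt_id.mul (differentiableAt_G hw N hz))).add
    ((differentiableAt_D hw N hz).const_mul _)

theorem differentiableAt_hSnd {w : ℝ → ℝ} (hw : IsWeight w) (N : ℕ) (y : ℂ) {z : ℂ}
    (hz : ‖z‖ ≠ 1) : DifferentiableAt ℂ (hSnd w (N + 1) y) z :=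
  differentiableAt_id.mul
    ((differentiableAt_J hw N hz).sub ((differentiableAt_G hw N hz).const_mul _))

theorem differentiableAt_h {w : ℝ → ℝ} (hw : IsWeight w) (N : ℕ) (x y : ℂ) {z : ℂ}
    (hz : ‖z‖ ≠ 1) : DifferentiableAt ℂ (h w (N + 1) x y) z :=
  ((differentiableAt_hFst hw N y hz).const_mul _).sub (differentiableAt_hSnd hw N y hz)

theorem deriv_h {w : ℝ → ℝ} (hw : IsWeight w) (N : ℕ) (x y : ℂ) {z : ℂ} (hz : ‖z‖ ≠ 1) :
    deriv (h w (N + 1) x y) z = starRingEnd ℂ x * deriv (hFst w (N + 1) y) z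
      - deriv (hSnd w (N + 1) y) z :=
  (((differentiableAt_hFst hw N y hz).hasDerivAt.const_mul _).sub
    (differentiableAt_hSnd hw N y hz).hasDerivAt).deriv

/-- This form covers β = 0 too, so the derivation of the equation needs no case distinction. -/
theorem wronskianQuotient_eq {w : ℝ → ℝ} (hw : IsWeight w) (N : ℕ) (β : ℂ) {z : ℂ}
    (hz : ‖z‖ ≠ 1) : wronskianQuotient w (N + 1) β z
      = wronskian (hSnd w (N + 1) β) (hFst w (N + 1) β) z := by
  rw [wronskianQuotient]
  split_ifs with hβ
  · have h1 : hSnd w (N + 1) β = fun s => s * J w (N + 1) s := by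
      funext s
      simp [hSnd, hβ]
    have h2 : hFst w (N + 1) β = fun s => ((N + 1 : ℕ) : ℂ) + s * G w (N + 1) s := by
      funext s
      simp [hFst, hβ]
    rw [h1, h2]
  · exact wronskian_h_div w (N + 1) β β z hβ (differentiableAt_hFst hw N β hz)
      (differentiableAt_hSnd hw N β hz)

theorem eval_paraOP_succ (μ : Measure ℝ) (N : ℕ) (β z : ℂ) :
    (paraOP μ (N + 1) β).eval z = z * (monicOP μ N).eval z
      - starRingEnd ℂ β * (revPoly N (monicOP μ N)).eval z := by
  simp [paraOP]

/-- The first derivative of `Φ_n(z; β)` in terms of `Φ_n(z; β)` and `Φ_{n-1}^*`. -/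
theorem mul_eval_derivative_paraOP {w : ℝ → ℝ} (hw : IsWeight w)
    [IsProbabilityMeasure (weightMeasure w)] (N : ℕ) (β : ℂ) {z : ℂ} (hz : ‖z‖ ≠ 1)
    (hz0 : z ≠ 0) :
    z * (derivative (paraOP (weightMeasure w) (N + 1) β)).eval z
      = hFst w (N + 1) β z * (paraOP (weightMeasure w) (N + 1) β).eval z
        + h w (N + 1) β β z * (revPoly N (monicOP (weightMeasure w) N)).eval z := by
  obtain ⟨h1, h2⟩ := monicOP_system hw N hz hz0
  simp only [paraOP, Nat.add_sub_cancel, derivative_sub, derivative_mul, derivative_X,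
    derivative_C, eval_sub, eval_add, eval_mul, eval_X, eval_C, one_mul,
    zero_mul, zero_add, h, hFst, hSnd]
  push_cast at h2 ⊢
  linear_combination z * h1 - z * starRingEnd ℂ β * h2

theorem paraOP_equation {w : ℝ → ℝ} (hw : IsWeight w) [IsProbabilityMeasure (weightMeasure w)]
    (N : ℕ) (β : ℂ) {z : ℂ} (hz : ‖z‖ ≠ 1) (hz0 : z ≠ 0) (hh : h w (N + 1) β β z ≠ 0) :
    0 = (paraOP (weightMeasure w) (N + 1) β).derivative.derivative.eval z
      + coeffOne w (N + 1) β z * (paraOP (weightMeasure w) (N + 1) β).derivative.eval z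
      + coeffZero w (N + 1) β z * (paraOP (weightMeasure w) (N + 1) β).eval z := by
  have hΨ := (monicOP_system hw N hz hz0).2
  have hy := mul_eval_derivative_paraOP hw N β hz hz0
  have hyp := eval_paraOP_succ (weightMeasure w) N β z
  have hev : (fun s => s * (derivative (paraOP (weightMeasure w) (N + 1) β)).eval s)
      =ᶠ[𝓝 z] fun s => hFst w (N + 1) β s * (paraOP (weightMeasure w) (N + 1) β).eval s
        + h w (N + 1) β β s * (revPoly N (monicOP (weightMeasure w) N)).eval s := by
    filter_upwards [continuous_norm.continuousAt.eventually_ne hz,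
      continuousAt_id.eventually_ne hz0] with s hs hs0
    exact mul_eval_derivative_paraOP hw N β hs hs0
  have hd := hev.deriv_eq
  have hdl := ((hasDerivAt_id z).mul
    ((derivative (paraOP (weightMeasure w) (N + 1) β)).hasDerivAt z)).deriv
  have hdr := (((differentiableAt_hFst hw N β hz).hasDerivAt.mul
    ((paraOP (weightMeasure w) (N + 1) β).hasDerivAt z)).add
    ((differentiableAt_h hw N β β hz).hasDerivAt.mul
      ((revPoly N (monicOP (weightMeasure w) N)).hasDerivAt z))).deriv
  have hd2 := (hdl.symm.trans hd).trans hdr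
  rw [deriv_h hw N β β hz] at hd2
  rw [coeffOne, coeffZero, wronskianQuotient_eq hw N β hz, wronskian, deriv_h hw N β β hz]
  simp only [id] at hd2
  have hhdef : h w (N + 1) β β z
    = starRingEnd ℂ β * hFst w (N + 1) β z - hSnd w (N + 1) β z := rfl
  have hF : hFst w (N + 1) β z
    = ((N + 1 : ℕ) : ℂ) * (1 - starRingEnd ℂ β * verblunsky (weightMeasure w) N)
      + z * G w (N + 1) z + starRingEnd ℂ β * D w (N + 1) z := rfl
  have hS : hSnd w (N + 1) β z
    = z * (J w (N + 1) z - starRingEnd ℂ β * G w (N + 1) z) := rfl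
  rw [Nat.add_sub_cancel]
  -- From here on the claim is algebra in the values at z, all analytic input being contained in
  -- `hd2`, `hΨ`, `hy` and `hyp`.
  generalize deriv (hFst w (N + 1) β) z = F' at *
  generalize deriv (hSnd w (N + 1) β) z = S' at *
  generalize h w (N + 1) β β z = H at *
  generalize hFst w (N + 1) β z = F at *
  generalize hSnd w (N + 1) β z = S at *
  generalize G w (N + 1) z = g at *
  generalize D w (N + 1) z = d at *
  generalize J w (N + 1) z = j at *
  generalize verblunsky (weightMeasure w) N = α at *
  generalize (paraOP (weightMeasure w) (N + 1) β).derivative.derivative.eval z = y2 at *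
  generalize (paraOP (weightMeasure w) (N + 1) β).derivative.eval z = y1 at *
  generalize (paraOP (weightMeasure w) (N + 1) β).eval z = y0 at *
  generalize (derivative (revPoly N (monicOP (weightMeasure w) N))).eval z = u1 at *
  generalize (revPoly N (monicOP (weightMeasure w) N)).eval z = u at *
  generalize (monicOP (weightMeasure w) N).eval z = v at *
  generalize starRingEnd ℂ β = b at *
  generalize (((N + 1 : ℕ) : ℂ)) = n at *
  have hv : z * v = y0 + b * u := by linear_combination -hyp
  have hkey : z * (z * H * y2 + (1 - n) * H * y1 - z * (b * F' - S') * y1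
      + (S * F' - F * S') * y0 - H * ((n + z * g) * g + j * (d - n * α)) * y0) = 0 := by
    -- The multipliers eliminate in turn Ψ' (`u1`), Φ (`v`) and Ψ (`u`); the last one is whatever
    -- coefficient of Ψ remains, divided by H. Eliminating Φ through zΦ = y + conj β Ψ costs the
    -- extra factor z, cancelled afterwards.
    have hsum : z * H * (y1 + z * y2) - z * H * (F' * y0 + F * y1 + (b * F' - S') * u + H * u1)
        + z * H ^ 2 * (u1 - ((n * α - d) * v - g * u))
        + H ^ 2 * (n * α - d) * (z * v - (y0 + b * u))
        + (-z * (b * F' - S') + z * H * g - H * (n * α - d) * b)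
          * (z * y1 - (F * y0 + H * u)) = 0 := by
      linear_combination z * H * hd2 + z * H ^ 2 * hΨ + H ^ 2 * (n * α - d) * hv
        + (-z * (b * F' - S') + z * H * g - H * (n * α - d) * b) * hy
    subst hhdef hF hS
    linear_combination hsum
  have hkey' := (mul_eq_zero.1 hkey).resolve_left hz0
  rw [eq_comm, ← mul_eq_zero_iff_left (mul_ne_zero hz0 hh), ← hkey']
  field_simp
  ring

/-! ### Continuation -/

theorem eventually_eventually_nhds_of_isDomainAt {U : Set ℂ} {l : Filter ℂ}
    (hU : IsDomainAt U l) {p : ℂ → Prop} (hp : ∀ᶠ z in l, p z) :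
    ∀ᶠ z in l, ∀ᶠ s in 𝓝 z, p s := by
  obtain ⟨-, -, ⟨-, rfl⟩ | ⟨-, rfl⟩⟩ := hU
  · filter_upwards [eventually_eventually_nhdsWithin.2 hp, self_mem_nhdsWithin] with z hz hz0
    rwa [isOpen_compl_singleton.nhdsWithin_eq hz0] at hz
  · obtain ⟨R, -, hR⟩ := hasBasis_cobounded_norm.eventually_iff.1 hp
    filter_upwards [tendsto_norm_cobounded_atTop.eventually_gt_atTop R] with z hz
    filter_upwards [continuous_norm.continuousAt.eventually_const_lt hz] with s hs
    exact hR (le_of_lt hs)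

theorem eventually_mem_of_isDomainAt {U : Set ℂ} {l : Filter ℂ} (hU : IsDomainAt U l) :
    ∀ᶠ z in l, z ∈ U ∧ z ≠ 0 ∧ ‖z‖ ≠ 1 := by
  obtain ⟨ho, -, ⟨h0, rfl⟩ | ⟨hb, rfl⟩⟩ := hU
  · have h1 : ∀ᶠ z : ℂ in 𝓝 0, ‖z‖ ≠ 1 :=
      continuous_norm.continuousAt.eventually_ne (by simp)
    filter_upwards [nhdsWithin_le_nhds (ho.mem_nhds h0), self_mem_nhdsWithin,
      nhdsWithin_le_nhds h1] with z hz hz0 hz1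
    exact ⟨hz, hz0, hz1⟩
  · have h1 : ∀ᶠ z : ℂ in Bornology.cobounded ℂ, 1 < ‖z‖ :=
      tendsto_norm_cobounded_atTop.eventually_gt_atTop 1
    filter_upwards [hb, h1] with z hz hz1
    refine ⟨hz, ?_, hz1.ne'⟩
    rintro rfl
    simp at hz1
    linarith

/-- A meromorphic function on a connected set that vanishes near one point vanishes wherever it
is analytic. -/
theorem eq_zero_of_meromorphicOn {f : ℂ → ℂ} {U : Set ℂ} (hU : IsConnected U)
    (hf : MeromorphicOn f U) {z₀ : ℂ} (hz₀ : z₀ ∈ U) (h0 : f =ᶠ[𝓝 z₀] 0) {z : ℂ} (hz : z ∈ U)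
    (hc : ContinuousAt f z) : f z = 0 := by
  have htop : meromorphicOrderAt f z = ⊤ := by
    by_contra hne
    refine hf.meromorphicOrderAt_ne_top_of_isPreconnected hU.isPreconnected hz hz₀ hne ?_
    rw [meromorphicOrderAt_eq_top_iff]
    exact h0.filter_mono nhdsWithin_le_nhds
  rw [meromorphicOrderAt_eq_top_iff] at htop
  exact tendsto_nhds_unique_of_eventuallyEq (hc.tendsto.mono_left nhdsWithin_le_nhds)
    (tendsto_const_nhds (x := (0 : ℂ))) htop

end OPUC

end

theorem mainTheorem1 (w : ℝ → ℝ)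
    (hw_cont : ContinuousOn w (Set.Icc 0 (2 * Real.pi)))
    (hw_per : w 0 = w (2 * Real.pi))
    (hw_nonneg : ∀ θ ∈ Set.Icc 0 (2 * Real.pi), 0 ≤ w θ)
    (hw_diff : ∀ θ ∈ Set.Ioo 0 (2 * Real.pi), DifferentiableAt ℝ w θ)
    (hw_int : IntegrableOn (deriv w) (Set.Ioo 0 (2 * Real.pi)))
    (hw_prob : IsProbabilityMeasure (OPUC.weightMeasure w))
    (n : ℕ) (hn : 1 ≤ n) (β : ℂ) :
    -- the equation holds wherever the integrals and the quotients make sense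
    (∀ z : ℂ, ‖z‖ ≠ 1 → z ≠ 0 → OPUC.h w n β β z ≠ 0 →
      0 = (OPUC.paraOP (OPUC.weightMeasure w) n β).derivative.derivative.eval z
        + OPUC.coeffOne w n β z
          * (OPUC.paraOP (OPUC.weightMeasure w) n β).derivative.eval z
        + OPUC.coeffZero w n β z
          * (OPUC.paraOP (OPUC.weightMeasure w) n β).eval z) ∧
    -- and it persists on every domain to which the coefficients extend meromorphically
    -- from a neighbourhood of zero or of infinity
    (∀ (U : Set ℂ) (l : Filter ℂ), OPUC.IsDomainAt U l →
      (∃ᶠ z in l, OPUC.h w n β β z ≠ 0) →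
      ∀ P Q : ℂ → ℂ, MeromorphicOn P U → MeromorphicOn Q U →
        P =ᶠ[l] OPUC.coeffOne w n β → Q =ᶠ[l] OPUC.coeffZero w n β →
        ∀ z ∈ U, AnalyticAt ℂ P z → AnalyticAt ℂ Q z →
          0 = (OPUC.paraOP (OPUC.weightMeasure w) n β).derivative.derivative.eval z
            + P z * (OPUC.paraOP (OPUC.weightMeasure w) n β).derivative.eval z
            + Q z * (OPUC.paraOP (OPUC.weightMeasure w) n β).eval z) := by
  have hw : OPUC.IsWeight w := ⟨hw_cont, hw_per, hw_nonneg, hw_diff, hw_int⟩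
  obtain ⟨N, rfl⟩ : ∃ N, n = N + 1 := ⟨n - 1, by omega⟩
  have heq := fun (z : ℂ) (hz : ‖z‖ ≠ 1) (hz0 : z ≠ 0) => OPUC.paraOP_equation hw N β hz hz0
  refine ⟨heq, ?_⟩
  intro U l hU hfreq P Q hP hQ hPl hQl z hzU hPz hQz
  set y := OPUC.paraOP (OPUC.weightMeasure w) (N + 1) β
  have hpoly : ∀ p : ℂ[X], AnalyticOnNhd ℂ (fun s => p.eval s) Set.univ := fun p s _ =>
    (p.differentiable.analyticAt s)
  have hmer : MeromorphicOn (fun s => y.derivative.derivative.eval s + P s * y.derivative.eval s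
      + Q s * y.eval s) U := fun s hs =>
    ((hpoly _ s trivial).meromorphicAt.add
      ((hP s hs).mul (hpoly _ s trivial).meromorphicAt)).add
      ((hQ s hs).mul (hpoly _ s trivial).meromorphicAt)
  have hcont : ContinuousAt (fun s => y.derivative.derivative.eval s + P s * y.derivative.eval s
      + Q s * y.eval s) z :=
    ((hpoly _ z trivial).continuousAt.add
      (hPz.continuousAt.mul (hpoly _ z trivial).continuousAt)).add
      (hQz.continuousAt.mul (hpoly _ z trivial).continuousAt)
  have hev := OPUC.eventually_mem_of_isDomainAt hU
  have hloc := OPUC.eventually_eventually_nhds_of_isDomainAt hU ((hPl.and hQl).and hev)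
  -- A base point for the identity theorem: around it P and Q are the original coefficients, and h
  -- is nonzero there, hence nearby by continuity. Elsewhere, in particular across the circle, the
  -- extensions need not agree with those formulas.
  obtain ⟨z₀, hh0, hz₀, hz₀U, -, hz₀1⟩ := (hfreq.and_eventually (hloc.and hev)).exists
  refine (OPUC.eq_zero_of_meromorphicOn hU.2.1 hmer hz₀U ?_ hzU hcont).symm
  filter_upwards [hz₀, (OPUC.differentiableAt_h hw N β β hz₀1).continuousAt.eventually_ne hh0]
    with s hs hhs
  obtain ⟨⟨hPs, hQs⟩, -, hs0, hs1⟩ := hs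
  rw [hPs, hQs]
  exact (heq s hs1 hs0 hhs).symm
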